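/- There exists a numerical constant $\kappa>0$ such that the following holds for every $n$. Let $\mu$ be a compactly supported Borel probability measure on $\mathbb{R}^n$, let $K$ be the convex hull of its support, and assume that the Euclidean diameter of $K$ is $\sqrt{n}$. Let $f:\mathbb{R}^n\to\mathbb{R}$ be continuously differentiable and let $V=\nabla f(K)$. Then $$\log\int e^{f}\,d\mu \;\le\; \sup_{y\in\mathbb{R}^n}\{f(y)-\Lambda^*_\mu(y)\}+\kappa\, n^{1/3} g(V)^{2/3}.$$ Here $\Lambda_\mu(\lambda)=\log\int e^{\langle\lambda,x\rangle}\,d\mu(x)$ is the logarithmic Laplace transform of $\mu$, $\Lambda^*_\mu(x)=\sup_{\lambda\in\mathbb{R}^n}\{\langle\lambda,x\rangle-\Lambda_\mu(\lambda)\}\in(-\infty,+\infty]$ is its Legendre transform, and $$g(V)=\mathbb{E}\sup_{\zeta\in V}\langle\zeta,\Gamma\rangle$$ is the Gaussian mean-width of $V$, where $\Gamma$ is a standard Gaussian vector in $\mathbb{R}^n$. -/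

import Mathlib

open MeasureTheory ProbabilityTheory
open scoped RealInnerProductSpace Gradient

/-- The logarithmic Laplace transform `Λ_μ(l) = log ∫ e^{⟨l, x⟩} dμ(x)`, with value `⊤` where the
integral is infinite. -/
noncomputable def logLaplace {n : ℕ} (μ : Measure (EuclideanSpace ℝ (Fin n)))
    (l : EuclideanSpace ℝ (Fin n)) : EReal :=
  ENNReal.log (∫⁻ x, ENNReal.ofReal (Real.exp ⟪l, x⟫) ∂μ)

/-- The Legendre transform `Λ*(x) = sup_l {⟨l, x⟩ - Λ(l)}` of an extended-real-valued function. -/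
noncomputable def legendreTransform {n : ℕ} (L : EuclideanSpace ℝ (Fin n) → EReal)
    (x : EuclideanSpace ℝ (Fin n)) : EReal :=
  ⨆ l : EuclideanSpace ℝ (Fin n), ((⟪l, x⟫ : ℝ) : EReal) - L l

/-- The Gaussian mean-width `g(V) = E sup_{z ∈ V} ⟨z, Γ⟩` of a bounded nonempty set `V`, where `Γ`
is a standard Gaussian vector in `ℝⁿ`. -/
noncomputable def gaussianMeanWidth {n : ℕ} (V : Set (EuclideanSpace ℝ (Fin n))) : ℝ :=
  ∫ γ, (⨆ z : V, ⟪(z : EuclideanSpace ℝ (Fin n)), γ⟫) ∂(stdGaussian (EuclideanSpace ℝ (Fin n)))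

/-! Let `V = ∇f(K)`, with support function `h`. The mean value theorem gives `f x - f y ≤ h (x -
y)`. Fix a centre `z` and tilt `μ` by `exp (-h (z - ·))`; let `y` be the barycentre of the tilt.
Jensen bounds `Λ* y` by means of the tilt's normalising constant, and subadditivity of `h` then
gives `log ∫ exp (f x - h (x - z) - h (z - x)) dμ ≤ f y - Λ* y`, with no error term
(`exists_log_integral_le_sub_legendreTransform`).

The penalty is removed by averaging over `z = x₀ + r Γ`, with `x₀` in the support. By Cameron-Martin
and Jensen its average is at least `exp (-n / (2 r²) - 2 r g(V))` on the support
(`exp_le_integral_stdGaussian`). Fubini and the choice `r ≈ (n / g(V))^(1/3)` give the error term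
with `κ = 5/2`. -/

section Integrability

variable {E : Type*} [NormedAddCommGroup E] [MeasurableSpace E] [BorelSpace E]
  [SecondCountableTopology E]

/-- A continuous function is integrable against a finite measure concentrated on a compact set. -/
lemma Continuous.integrable_of_ae_mem_isCompact {F : Type*} [NormedAddCommGroup F]
    {ρ : Measure E} [IsFiniteMeasure ρ] {S : Set E} (hS : IsCompact S)
    (hρ : ∀ᵐ x ∂ρ, x ∈ S) {g : E → F} (hg : Continuous g) : Integrable g ρ := by
  obtain ⟨C, hC⟩ := hS.exists_bound_of_continuousOn hg.continuousOn
  exact Integrable.of_bound hg.aestronglyMeasurable C (hρ.mono fun x hx ↦ hC x hx)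

end Integrability

/-- Jensen's inequality for the exponential function. -/
lemma Real.exp_integral_le_integral_exp {α : Type*} [MeasurableSpace α] {ν : Measure α}
    [IsProbabilityMeasure ν] {g : α → ℝ} (hg : Integrable g ν)
    (hexp : Integrable (fun x ↦ Real.exp (g x)) ν) :
    Real.exp (∫ x, g x ∂ν) ≤ ∫ x, Real.exp (g x) ∂ν :=
  convexOn_exp.map_integral_le Real.continuous_exp.continuousOn isClosed_univ (by simp) hg hexp

/-! ### Support functions of bounded sets -/

section SupportFunction

variable {E : Type*} [NormedAddCommGroup E] [InnerProductSpace ℝ E]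

/-- The support function `u ↦ sup_{z ∈ V} ⟨z, u⟩` of a set `V`. -/
noncomputable def supportFunction (V : Set E) (u : E) : ℝ := ⨆ z : V, ⟪(z : E), u⟫

variable {V : Set E}

lemma bddAbove_range_inner (hV : Bornology.IsBounded V) (u : E) :
    BddAbove (Set.range fun z : V ↦ ⟪(z : E), u⟫) := by
  obtain ⟨R, hR⟩ := hV.exists_norm_le
  refine ⟨R * ‖u‖, ?_⟩
  rintro _ ⟨z, rfl⟩
  exact (real_inner_le_norm _ _).trans (by gcongr; exact hR z z.2)

lemma inner_le_supportFunction (hV : Bornology.IsBounded V) {z : E} (hz : z ∈ V) (u : E) :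
    ⟪z, u⟫ ≤ supportFunction V u :=
  le_ciSup (bddAbove_range_inner hV u) ⟨z, hz⟩

lemma supportFunction_le (hne : V.Nonempty) {u : E} {c : ℝ} (h : ∀ z ∈ V, ⟪z, u⟫ ≤ c) :
    supportFunction V u ≤ c := by
  have := hne.to_subtype
  exact ciSup_le fun z ↦ h z z.2

lemma supportFunction_add_le (hV : Bornology.IsBounded V) (hne : V.Nonempty) (u v : E) :
    supportFunction V (u + v) ≤ supportFunction V u + supportFunction V v :=
  supportFunction_le hne fun z hz ↦ by
    rw [inner_add_right]
    exact add_le_add (inner_le_supportFunction hV hz u) (inner_le_supportFunction hV hz v)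

lemma supportFunction_smul {r : ℝ} (hr : 0 ≤ r) (u : E) :
    supportFunction V (r • u) = r * supportFunction V u := by
  simp_rw [supportFunction, inner_smul_right, Real.mul_iSup_of_nonneg hr]

lemma continuous_supportFunction (hV : Bornology.IsBounded V) (hne : V.Nonempty) :
    Continuous (supportFunction V) := by
  obtain ⟨R, hR⟩ := hV.exists_norm_le
  have hR0 : 0 ≤ R := (norm_nonneg _).trans (hR _ hne.some_mem)
  refine (LipschitzWith.of_le_add_mul (Real.toNNReal R) fun u v ↦ ?_).continuous
  rw [Real.coe_toNNReal R hR0]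
  refine supportFunction_le hne fun z hz ↦ ?_
  have h1 := inner_le_supportFunction hV hz v
  have h2 : ⟪z, u⟫ = ⟪z, v⟫ + ⟪z, u - v⟫ := by rw [← inner_add_right]; simp
  have h3 : ⟪z, u - v⟫ ≤ R * dist u v := by
    rw [dist_eq_norm]
    exact (real_inner_le_norm _ _).trans (by gcongr; exact hR z hz)
  linarith

lemma supportFunction_add_neg_nonneg (hV : Bornology.IsBounded V) (hne : V.Nonempty) (u : E) :
    0 ≤ supportFunction V u + supportFunction V (-u) := by
  obtain ⟨z, hz⟩ := hne
  have h1 := inner_le_supportFunction hV hz u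
  have h2 := inner_le_supportFunction hV hz (-u)
  rw [inner_neg_right] at h2
  linarith

lemma abs_supportFunction_le (hV : Bornology.IsBounded V) (hne : V.Nonempty) :
    ∃ R, ∀ u, |supportFunction V u| ≤ R * ‖u‖ := by
  obtain ⟨R, hR⟩ := hV.exists_norm_le
  have key : ∀ z ∈ V, ∀ u, |⟪z, u⟫| ≤ R * ‖u‖ := fun z hz u ↦
    (abs_real_inner_le_norm _ _).trans (by gcongr; exact hR z hz)
  refine ⟨R, fun u ↦ abs_le.2 ⟨?_, supportFunction_le hne fun z hz ↦
    (le_abs_self _).trans (key z hz u)⟩⟩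
  obtain ⟨z, hz⟩ := hne
  exact (abs_le.1 (key z hz u)).1.trans (inner_le_supportFunction hV hz u)

/-- Jensen for a supremum of linear forms: each form commutes with the integral. -/
lemma supportFunction_integral_le [CompleteSpace E] (hV : Bornology.IsBounded V)
    (hne : V.Nonempty) {α : Type*} [MeasurableSpace α] {ν : Measure α} {X : α → E}
    (hX : Integrable X ν) (hh : Integrable (fun a ↦ supportFunction V (X a)) ν) :
    supportFunction V (∫ a, X a ∂ν) ≤ ∫ a, supportFunction V (X a) ∂ν :=
  supportFunction_le hne fun z hz ↦ by
    rw [← integral_inner hX z]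
    exact integral_mono (hX.const_inner z) hh fun a ↦ inner_le_supportFunction hV hz (X a)

end SupportFunction

/-! ### Gaussian shifts and averages -/

section Gaussian

variable {E : Type*} [NormedAddCommGroup E] [InnerProductSpace ℝ E] [FiniteDimensional ℝ E]
  [MeasurableSpace E] [BorelSpace E]

lemma integrable_exp_neg_half_norm_sq :
    Integrable (fun x : E ↦ Real.exp (-(1 / 2) * ‖x‖ ^ 2)) := by
  have h := (GaussianFourier.integrable_cexp_neg_mul_sq_norm_add (V := E) (b := (1 / 2 : ℂ))
    (by norm_num) 0 0).re
  refine h.congr (.of_forall fun x ↦ ?_)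
  have : (-(1 / 2 : ℂ) * (‖x‖ : ℂ) ^ 2 + 0 * (⟪(0 : E), x⟫ : ℂ))
      = ((-(1 / 2) * ‖x‖ ^ 2 : ℝ) : ℂ) := by push_cast; ring
  simp only [this, ← Complex.ofReal_exp]
  exact RCLike.ofReal_re (K := ℂ) _

/-- The standard Gaussian measure has density proportional to `exp (-‖x‖² / 2)`. -/
lemma stdGaussian_eq_tilted_volume :
    stdGaussian E = (volume : Measure E).tilted fun x ↦ -(1 / 2) * ‖x‖ ^ 2 := by
  have hint := integrable_exp_neg_half_norm_sq (E := E)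
  have := isProbabilityMeasure_tilted (μ := (volume : Measure E)) hint
  refine Measure.ext_of_charFun ?_
  ext t
  rw [charFun_stdGaussian, charFun_apply, integral_tilted]
  have h1 := GaussianFourier.integral_cexp_neg_mul_sq_norm_add (V := E) (b := (1 / 2 : ℂ))
    (by norm_num) Complex.I t
  have h2 : ((∫ x : E, Real.exp (-(1 / 2) * ‖x‖ ^ 2) : ℝ) : ℂ) =
      (Real.pi / (1 / 2 : ℂ)) ^ (Module.finrank ℝ E / 2 : ℂ) := by
    rw [GaussianFourier.integral_rexp_neg_mul_sq_norm (by norm_num : (0 : ℝ) < 1 / 2),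
      Complex.ofReal_cpow (by positivity)]
    push_cast
    rfl
  have h3 : ∀ x : E, (Real.exp (-(1 / 2) * ‖x‖ ^ 2) / ∫ x : E, Real.exp (-(1 / 2) * ‖x‖ ^ 2)) •
      Complex.exp (⟪x, t⟫ * Complex.I) =
      ((∫ x : E, Real.exp (-(1 / 2) * ‖x‖ ^ 2) : ℝ) : ℂ)⁻¹ *
        Complex.exp (-(1 / 2) * ‖x‖ ^ 2 + Complex.I * ⟪t, x⟫) := by
    intro x
    rw [Complex.exp_add, real_inner_comm, Complex.real_smul]
    push_cast
    ring_nf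
  simp_rw [h3]
  rw [integral_const_mul, h1, ← h2, ← mul_assoc, inv_mul_cancel₀, one_mul, Complex.I_sq]
  · congr 1; ring
  · exact_mod_cast (integral_exp_pos hint).ne'

/-- The Cameron-Martin formula for the standard Gaussian measure. -/
lemma integral_stdGaussian_add_right {F : Type*} [NormedAddCommGroup F] [NormedSpace ℝ F]
    (G : E → F) (a : E) :
    ∫ x, G x ∂(stdGaussian E) =
      ∫ x, Real.exp (-⟪x, a⟫ - ‖a‖ ^ 2 / 2) • G (x + a) ∂(stdGaussian E) := by
  rw [stdGaussian_eq_tilted_volume, integral_tilted, integral_tilted,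
    ← integral_add_right_eq_self _ a]
  congr 1 with x
  rw [smul_smul, norm_add_sq_real, div_mul_eq_mul_div, ← Real.exp_add]
  congr 3
  ring_nf

lemma map_neg_stdGaussian : (stdGaussian E).map (fun x ↦ -x) = stdGaussian E :=
  stdGaussian_map (LinearIsometryEquiv.neg ℝ (E := E))

lemma integral_comp_neg_stdGaussian (G : E → ℝ) :
    ∫ x, G (-x) ∂(stdGaussian E) = ∫ x, G x ∂(stdGaussian E) := by
  conv_rhs => rw [← map_neg_stdGaussian]
  exact ((MeasurableEquiv.neg E).measurableEmbedding.integral_map G).symm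

variable {V : Set E}

lemma integrable_supportFunction_stdGaussian (hV : Bornology.IsBounded V) (hne : V.Nonempty) :
    Integrable (supportFunction V) (stdGaussian E) := by
  obtain ⟨R, hR⟩ := abs_supportFunction_le hV hne
  exact ((IsGaussian.integrable_id (μ := stdGaussian E)).norm.const_mul R).mono'
    (continuous_supportFunction hV hne).aestronglyMeasurable (.of_forall hR)

/-- By symmetry of the Gaussian, twice this mean is the mean of `h x + h (-x) ≥ 0`. -/
lemma integral_supportFunction_stdGaussian_nonneg (hV : Bornology.IsBounded V)
    (hne : V.Nonempty) : 0 ≤ ∫ x, supportFunction V x ∂(stdGaussian E) := by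
  have h := integrable_supportFunction_stdGaussian hV hne
  have h0 : 0 ≤ ∫ x, (supportFunction V x + supportFunction V (-x)) ∂(stdGaussian E) :=
    integral_nonneg fun x ↦ supportFunction_add_neg_nonneg hV hne x
  have h' : Integrable (fun x ↦ supportFunction V (-x)) (stdGaussian E) := by
    rw [← map_neg_stdGaussian] at h
    exact h.comp_measurable measurable_neg
  rw [integral_add h h', integral_comp_neg_stdGaussian] at h0
  linarith

/-- A lower bound for the Gaussian average of `exp (-p (x - ·))`, for the seminorm
`p u = h u + h (-u)` attached to the support function `h` of `V`. -/
lemma exp_le_integral_stdGaussian (hV : Bornology.IsBounded V) (hne : V.Nonempty) {r : ℝ}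
    (hr : 0 < r) (u : E) :
    Real.exp (-(‖u‖ ^ 2 / (2 * r ^ 2)) - 2 * r * ∫ x, supportFunction V x ∂(stdGaussian E)) ≤
      ∫ x, Real.exp (-(supportFunction V (u - r • x) + supportFunction V (r • x - u)))
        ∂(stdGaussian E) := by
  obtain ⟨a, hu⟩ : ∃ a, u = r • a := ⟨r⁻¹ • u, by simp [hr.ne']⟩
  have hcont := continuous_supportFunction hV hne
  have h := integrable_supportFunction_stdGaussian hV hne
  have h' : Integrable (fun x ↦ supportFunction V (-x)) (stdGaussian E) := by
    rw [← map_neg_stdGaussian] at h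
    exact h.comp_measurable measurable_neg
  have hid : Integrable (fun x : E ↦ ⟪x, a⟫) (stdGaussian E) :=
    (IsGaussian.integrable_id (μ := stdGaussian E)).inner_const a
  have hexpid : Integrable (fun x : E ↦ Real.exp (-⟪x, a⟫ - ‖a‖ ^ 2 / 2)) (stdGaussian E) := by
    -- A non-integrable function has integral 0 by convention, whereas Cameron-Martin applied to the
    -- constant 1 gives 1.
    refine Integrable.of_integral_ne_zero ?_
    have := integral_stdGaussian_add_right (fun _ : E ↦ (1 : ℝ)) a
    simp only [smul_eq_mul, mul_one, integral_const, probReal_univ] at this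
    rw [← this]
    exact one_ne_zero
  -- The exponent after shifting by `a = u / r`. Its linear term has mean zero and `h x`, `h (-x)`
  -- have equal means, whence the factor `2 r`.
  set φ : E → ℝ := fun x ↦
    -⟪x, a⟫ - ‖a‖ ^ 2 / 2 - r * (supportFunction V x + supportFunction V (-x)) with hφ
  have hφi : Integrable φ (stdGaussian E) :=
    (hid.neg.sub (integrable_const _)).sub ((h.add h').const_mul r)
  have hφint : ∫ x, φ x ∂(stdGaussian E) =
      -(‖u‖ ^ 2 / (2 * r ^ 2)) - 2 * r * ∫ x, supportFunction V x ∂(stdGaussian E) := by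
    have e0 : ∫ x : E, ⟪x, a⟫ ∂(stdGaussian E) = 0 := by
      simp_rw [real_inner_comm a]
      exact (integral_inner (μ := stdGaussian E) IsGaussian.integrable_id a).trans (by simp)
    have e1 : ∫ x, φ x ∂(stdGaussian E) = -0 - ‖a‖ ^ 2 / 2 -
        r * (∫ x, supportFunction V x ∂(stdGaussian E) +
          ∫ x, supportFunction V x ∂(stdGaussian E)) := by
      have e2 : φ = (-fun x ↦ ⟪x, a⟫) - (fun _ ↦ ‖a‖ ^ 2 / 2) -
          fun x ↦ r * (supportFunction V + fun x ↦ supportFunction V (-x)) x := rfl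
      rw [e2, integral_sub' (hid.neg.sub (integrable_const _)) ((h.add h').const_mul r),
        integral_sub' hid.neg (integrable_const _), integral_neg', e0, integral_const_mul,
        integral_add' h h', integral_comp_neg_stdGaussian]
      simp
    rw [e1, hu, norm_smul, Real.norm_of_nonneg hr.le]
    field_simp
    ring
  have hexpφ : Integrable (fun x ↦ Real.exp (φ x)) (stdGaussian E) := by
    refine hexpid.mono' (by fun_prop) (.of_forall fun x ↦ ?_)
    rw [Real.norm_of_nonneg (Real.exp_pos _).le]
    refine Real.exp_le_exp.2 (sub_le_self _ ?_)
    exact mul_nonneg hr.le (supportFunction_add_neg_nonneg hV hne x)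
  rw [← hφint, integral_stdGaussian_add_right (fun x ↦ Real.exp (-(_ + _))) a]
  refine (Real.exp_integral_le_integral_exp hφi hexpφ).trans_eq ?_
  congr 1 with x
  have e1 : u - r • (x + a) = r • (-x) := by rw [hu]; simp
  have e2 : r • (x + a) - u = r • x := by rw [hu]; simp
  rw [e1, e2, supportFunction_smul hr.le, supportFunction_smul hr.le, smul_eq_mul, ← Real.exp_add]
  congr 1
  simp only [hφ]
  ring

end Gaussian

/-! ### Gradient image and mean value inequality -/

section Gradient

variable {E : Type*} [NormedAddCommGroup E] [InnerProductSpace ℝ E] [CompleteSpace E]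

lemma ContDiff.continuous_gradient {f : E → ℝ} (hf : ContDiff ℝ 1 f) : Continuous (∇ f) :=
  (InnerProductSpace.toDual ℝ E).symm.continuous.comp (hf.continuous_fderiv one_ne_zero)

lemma ContDiff.isBounded_gradient_image [FiniteDimensional ℝ E] {f : E → ℝ}
    (hf : ContDiff ℝ 1 f) {s : Set E} (hs : Bornology.IsBounded s) :
    Bornology.IsBounded (∇ f '' s) :=
  (hs.isCompact_closure.image hf.continuous_gradient).isBounded.subset
    (Set.image_mono subset_closure)

/-- Mean value inequality for the support function of the gradient image of a convex set. -/
lemma ContDiff.sub_le_supportFunction_gradient {f : E → ℝ} (hf : ContDiff ℝ 1 f) {K : Set E}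
    (hK : Convex ℝ K) (hV : Bornology.IsBounded (∇ f '' K)) {x y : E} (hx : x ∈ K)
    (hy : y ∈ closure K) : f x - f y ≤ supportFunction (∇ f '' K) (x - y) := by
  have hne : (∇ f '' K).Nonempty := ⟨_, x, hx, rfl⟩
  have hcont := continuous_supportFunction hV hne
  have hcf := hf.continuous
  refine closure_minimal (t := {y | f x - f y ≤ supportFunction (∇ f '' K) (x - y)}) ?_
    (isClosed_le (by fun_prop) (by fun_prop)) hy
  intro y hy
  obtain ⟨w, hw, hfw⟩ := domain_mvt (f := f) (f' := fderiv ℝ f) (s := K)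
    (fun w _ ↦ ((hf.differentiable one_ne_zero) w).hasFDerivAt.hasFDerivWithinAt) hK hy hx
  rw [Set.mem_ofPred_eq, hfw, ← inner_gradient_left]
  exact inner_le_supportFunction hV ⟨w, hK.segment_subset hy hx hw, rfl⟩ _

end Gradient

/-! ### Tilting at a fixed centre, then averaging over centres -/

section MeanField

variable {n : ℕ} {μ : Measure (EuclideanSpace ℝ (Fin n))} [IsProbabilityMeasure μ]
  {S V : Set (EuclideanSpace ℝ (Fin n))} {f : EuclideanSpace ℝ (Fin n) → ℝ}

lemma logLaplace_eq_log_integral (hS : IsCompact S) (hμ : ∀ᵐ x ∂μ, x ∈ S)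
    (l : EuclideanSpace ℝ (Fin n)) :
    logLaplace μ l = (Real.log (∫ x, Real.exp ⟪l, x⟫ ∂μ) : EReal) := by
  have hint : Integrable (fun x ↦ Real.exp ⟪l, x⟫) μ :=
    Continuous.integrable_of_ae_mem_isCompact hS hμ (by fun_prop)
  rw [logLaplace, ← ofReal_integral_eq_lintegral_ofReal hint
    (.of_forall fun x ↦ (Real.exp_pos _).le), ENNReal.log_ofReal_of_pos (integral_exp_pos hint)]

/-- At the barycenter `y` of the tilted measure, the Legendre transform of the logarithmic Laplace
transform is controlled by the tilt. -/
lemma legendreTransform_logLaplace_le (hS : IsCompact S) (hμ : ∀ᵐ x ∂μ, x ∈ S)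
    (hV : Bornology.IsBounded V) (hne : V.Nonempty) (z : EuclideanSpace ℝ (Fin n)) :
    legendreTransform (logLaplace μ) (∫ x, x ∂(μ.tilted fun x ↦ -supportFunction V (z - x))) ≤
      ((-Real.log (∫ x, Real.exp (-supportFunction V (z - x)) ∂μ) - supportFunction V
        (z - ∫ x, x ∂(μ.tilted fun x ↦ -supportFunction V (z - x))) : ℝ) : EReal) := by
  have hcont := continuous_supportFunction hV hne
  set M := ∫ x, Real.exp (-supportFunction V (z - x)) ∂μ with hM
  set ν := μ.tilted fun x ↦ -supportFunction V (z - x) with hν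
  set y := ∫ x, x ∂ν with hy
  have hint : Integrable (fun x ↦ Real.exp (-supportFunction V (z - x))) μ :=
    Continuous.integrable_of_ae_mem_isCompact hS hμ (by fun_prop)
  have hMpos : 0 < M := integral_exp_pos hint
  have : IsProbabilityMeasure ν := isProbabilityMeasure_tilted hint
  have hνS : ∀ᵐ x ∂ν, x ∈ S := (tilted_absolutelyContinuous _ _).ae_le hμ
  have hid : Integrable (fun x ↦ x) ν :=
    Continuous.integrable_of_ae_mem_isCompact hS hνS continuous_id
  have hhi : Integrable (fun x ↦ supportFunction V (z - x)) ν :=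
    Continuous.integrable_of_ae_mem_isCompact hS hνS (by fun_prop)
  have hjensen : supportFunction V (z - y) ≤ ∫ x, supportFunction V (z - x) ∂ν := by
    have h := supportFunction_integral_le hV hne ((integrable_const z).sub hid) hhi
    rwa [integral_sub' (integrable_const z) hid, integral_const, probReal_univ, one_smul] at h
  refine iSup_le fun l ↦ ?_
  rw [logLaplace_eq_log_integral hS hμ, ← EReal.coe_sub, EReal.coe_le_coe_iff]
  -- Jensen is applied to this exponent because its `h` part cancels the density of the tilt,
  -- leaving the Laplace transform of `μ` divided by `M`.
  have hg : Integrable (fun x ↦ ⟪l, x⟫ + supportFunction V (z - x)) ν :=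
    Continuous.integrable_of_ae_mem_isCompact hS hνS (by fun_prop)
  have hexp := Real.exp_integral_le_integral_exp hg
    (Continuous.integrable_of_ae_mem_isCompact hS hνS (by fun_prop))
  have htilt : ∫ x, Real.exp (⟪l, x⟫ + supportFunction V (z - x)) ∂ν =
      ∫ x, (Real.exp (-supportFunction V (z - x)) / M) •
        Real.exp (⟪l, x⟫ + supportFunction V (z - x)) ∂μ := integral_tilted _ _
  rw [integral_add (hid.const_inner l) hhi, integral_inner hid l, htilt, ← hy] at hexp
  have hrew : ∀ x, (Real.exp (-supportFunction V (z - x)) / M) •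
      Real.exp (⟪l, x⟫ + supportFunction V (z - x)) = M⁻¹ * Real.exp ⟪l, x⟫ := by
    intro x
    rw [smul_eq_mul, div_mul_eq_mul_div, ← Real.exp_add, div_eq_inv_mul]
    congr 2
    ring
  simp_rw [hrew] at hexp
  rw [integral_const_mul, inv_mul_eq_div, le_div_iff₀ hMpos] at hexp
  have hlog := Real.log_le_log (by positivity) hexp
  rw [Real.log_mul (Real.exp_pos _).ne' hMpos.ne', Real.log_exp] at hlog
  linarith

/-- Bounding `f x - h (x - z)` by `f y + h (z - y)` leaves exactly the tilt's weight, and the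
surplus `h (z - y)` is cancelled by the bound on `Λ* y`. -/
lemma exists_log_integral_le_sub_legendreTransform (hS : IsCompact S) (hμ : ∀ᵐ x ∂μ, x ∈ S)
    (hV : Bornology.IsBounded V) (hne : V.Nonempty) (hf : Continuous f)
    (hfV : ∀ x ∈ S, ∀ y ∈ closure (convexHull ℝ S), f x - f y ≤ supportFunction V (x - y))
    (z : EuclideanSpace ℝ (Fin n)) :
    ∃ y, (Real.log (∫ x, Real.exp (f x - (supportFunction V (x - z) + supportFunction V (z - x)))
      ∂μ) : EReal) ≤ (f y : EReal) - legendreTransform (logLaplace μ) y := by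
  have hcont := continuous_supportFunction hV hne
  have hleg := legendreTransform_logLaplace_le hS hμ hV hne z
  set M := ∫ x, Real.exp (-supportFunction V (z - x)) ∂μ with hM
  set ν := μ.tilted fun x ↦ -supportFunction V (z - x) with hν
  set y := ∫ x, x ∂ν with hy
  have hint : Integrable (fun x ↦ Real.exp (-supportFunction V (z - x))) μ :=
    Continuous.integrable_of_ae_mem_isCompact hS hμ (by fun_prop)
  have hMpos : 0 < M := integral_exp_pos hint
  have : IsProbabilityMeasure ν := isProbabilityMeasure_tilted hint
  have hνS : ∀ᵐ x ∂ν, x ∈ S := (tilted_absolutelyContinuous _ _).ae_le hμ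
  have hymem : y ∈ closure (convexHull ℝ S) :=
    (convex_convexHull ℝ S).closure.integral_mem isClosed_closure
      (hνS.mono fun x hx ↦ subset_closure (subset_convexHull ℝ S hx))
      (Continuous.integrable_of_ae_mem_isCompact hS hνS continuous_id)
  have hFint : Integrable (fun x ↦ Real.exp
      (f x - (supportFunction V (x - z) + supportFunction V (z - x)))) μ :=
    Continuous.integrable_of_ae_mem_isCompact hS hμ (by fun_prop)
  have hle : ∫ x, Real.exp (f x - (supportFunction V (x - z) + supportFunction V (z - x))) ∂μ ≤
      Real.exp (f y + supportFunction V (z - y)) * M := by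
    rw [hM, ← integral_const_mul]
    refine integral_mono_ae hFint (hint.const_mul _) (hμ.mono fun x hx ↦ ?_)
    dsimp only
    rw [← Real.exp_add]
    refine Real.exp_le_exp.2 ?_
    have h1 := hfV x hx y hymem
    have h2 := supportFunction_add_le hV hne (x - z) (z - y)
    rw [sub_add_sub_cancel] at h2
    linarith
  refine ⟨y, le_trans ?_ (EReal.sub_le_sub le_rfl hleg)⟩
  rw [← EReal.coe_sub, EReal.coe_le_coe_iff]
  have hlog := Real.log_le_log (integral_exp_pos hFint) hle
  rw [Real.log_mul (Real.exp_pos _).ne' hMpos.ne', Real.log_exp] at hlog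
  linarith

/-- The mean-field bound with a free smoothing parameter `r`. -/
lemma log_integral_exp_le_of_pos (hS : IsCompact S) (hμ : ∀ᵐ x ∂μ, x ∈ S)
    (hV : Bornology.IsBounded V) (hne : V.Nonempty) (hf : Continuous f)
    (hfV : ∀ x ∈ S, ∀ y ∈ closure (convexHull ℝ S), f x - f y ≤ supportFunction V (x - y))
    {x₀ : EuclideanSpace ℝ (Fin n)} {D : ℝ} (hD : ∀ x ∈ S, ‖x - x₀‖ ≤ D) {q : ℝ}
    (hq : ∀ y, (f y : EReal) - legendreTransform (logLaplace μ) y ≤ (q : EReal))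
    {r : ℝ} (hr : 0 < r) :
    Real.log (∫ x, Real.exp (f x) ∂μ) ≤
      q + (D ^ 2 / (2 * r ^ 2) + 2 * r * gaussianMeanWidth V) := by
  have hcont := continuous_supportFunction hV hne
  set γ := stdGaussian (EuclideanSpace ℝ (Fin n)) with hγ
  have hfint : Integrable (fun x ↦ Real.exp (f x)) μ :=
    Continuous.integrable_of_ae_mem_isCompact hS hμ (by fun_prop)
  set c := Real.exp (-(D ^ 2 / (2 * r ^ 2)) - 2 * r * gaussianMeanWidth V) with hc
  set B : EuclideanSpace ℝ (Fin n) → EuclideanSpace ℝ (Fin n) → ℝ := fun x v ↦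
    Real.exp (f x - (supportFunction V (x - (x₀ + r • v)) + supportFunction V (x₀ + r • v - x)))
    with hB
  have hBint : Integrable (Function.uncurry B) (μ.prod γ) := by
    refine (hfint.comp_fst γ).mono' ?_ (.of_forall fun p ↦ ?_)
    · have : Continuous (Function.uncurry B) := by
        simp only [hB, Function.uncurry_def]; fun_prop
      exact this.aestronglyMeasurable
    · rw [Function.uncurry_def, Real.norm_of_nonneg (Real.exp_pos _).le]
      refine Real.exp_le_exp.2 (sub_le_self _ ?_)
      have := supportFunction_add_neg_nonneg hV hne (p.1 - (x₀ + r • p.2))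
      rwa [neg_sub] at this
  have hupper : ∀ v, ∫ x, B x v ∂μ ≤ Real.exp q := by
    intro v
    obtain ⟨y, hy⟩ := exists_log_integral_le_sub_legendreTransform hS hμ hV hne hf hfV (x₀ + r • v)
    have h1 := EReal.coe_le_coe_iff.1 (hy.trans (hq y))
    refine (Real.log_le_iff_le_exp (integral_exp_pos ?_)).1 h1
    exact Continuous.integrable_of_ae_mem_isCompact hS hμ (by fun_prop)
  have hlower : ∀ᵐ x ∂μ, c * Real.exp (f x) ≤ ∫ v, B x v ∂γ := by
    filter_upwards [hμ] with x hx
    have h1 := exp_le_integral_stdGaussian hV hne hr (x - x₀)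
    have h2 : c ≤ Real.exp (-(‖x - x₀‖ ^ 2 / (2 * r ^ 2)) - 2 * r * ∫ x, supportFunction V x ∂γ) := by
      refine Real.exp_le_exp.2 (sub_le_sub_right (neg_le_neg ?_) _)
      gcongr
      exact hD x hx
    have h3 := mul_le_mul_of_nonneg_right (h2.trans h1) (Real.exp_pos (f x)).le
    refine h3.trans_eq ?_
    rw [← integral_mul_const]
    congr 1 with v
    rw [hB, ← Real.exp_add, sub_sub, sub_sub_eq_add_sub, add_comm (r • v) x₀]
    congr 1
    ring
  have hmain : c * ∫ x, Real.exp (f x) ∂μ ≤ Real.exp q := by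
    rw [← integral_const_mul]
    refine (integral_mono_ae (hfint.const_mul c) hBint.integral_prod_left hlower).trans ?_
    refine (integral_integral_swap hBint).trans_le ?_
    refine (integral_mono hBint.integral_prod_right (integrable_const (Real.exp q)) hupper).trans_eq
      ?_
    simp
  have hlog := Real.log_le_log (mul_pos (Real.exp_pos _) (integral_exp_pos hfint)) hmain
  rw [Real.log_mul (Real.exp_pos _).ne' (integral_exp_pos hfint).ne', Real.log_exp,
    Real.log_exp] at hlog
  linarith

end MeanField

/-- Optimization of the smoothing parameter. -/
lemma le_of_forall_pos_le_smoothing {L N g : ℝ} (hN : 0 ≤ N) (hg : 0 ≤ g)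
    (h : ∀ r : ℝ, 0 < r → L ≤ N / (2 * r ^ 2) + 2 * r * g) :
    L ≤ 5 / 2 * N ^ ((1 : ℝ) / 3) * g ^ ((2 : ℝ) / 3) := by
  -- The perturbation `η` keeps the optimal radius defined and positive when `N` or `g` vanishes; it
  -- tends to 0 at the end.
  have key : ∀ η : ℝ, 0 < η →
      L ≤ 5 / 2 * (N + η) ^ ((1 : ℝ) / 3) * (g + η) ^ ((2 : ℝ) / 3) := by
    intro η hη
    have cube : ∀ a : ℝ, 0 < a → ∃ b : ℝ, 0 < b ∧ a = b ^ 3 ∧ a ^ ((1 : ℝ) / 3) = b ∧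
        a ^ ((2 : ℝ) / 3) = b ^ 2 := by
      intro a ha
      refine ⟨a ^ ((1 : ℝ) / 3), by positivity, ?_, rfl, ?_⟩
      · rw [← Real.rpow_natCast, ← Real.rpow_mul ha.le]; norm_num
      · rw [← Real.rpow_natCast, ← Real.rpow_mul ha.le]; norm_num
    obtain ⟨a, ha, hNa, ha1, -⟩ := cube (N + η) (by positivity)
    obtain ⟨b, hb, hgb, -, hb2⟩ := cube (g + η) (by positivity)
    rw [ha1, hb2]
    have h1 : N / (2 * (a / b) ^ 2) ≤ a ^ 3 / (2 * (a / b) ^ 2) := by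
      gcongr; linarith
    have h2 : 2 * (a / b) * g ≤ 2 * (a / b) * b ^ 3 := by
      gcongr; linarith
    -- With `r = a / b` the two terms become `a b² / 2` and `2 a b²`, whence `5/2`.
    refine (h (a / b) (by positivity)).trans ((add_le_add h1 h2).trans_eq ?_)
    field_simp
    ring
  have hlim : Filter.Tendsto
      (fun η : ℝ ↦ 5 / 2 * (N + η) ^ ((1 : ℝ) / 3) * (g + η) ^ ((2 : ℝ) / 3))
      (nhdsWithin 0 (Set.Ioi 0))
      (nhds (5 / 2 * N ^ ((1 : ℝ) / 3) * g ^ ((2 : ℝ) / 3))) := by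
    have : Continuous
        fun η : ℝ ↦ 5 / 2 * (N + η) ^ ((1 : ℝ) / 3) * (g + η) ^ ((2 : ℝ) / 3) :=
      (continuous_const.mul ((continuous_const.add continuous_id).rpow_const
        fun _ ↦ Or.inr (by norm_num))).mul
        ((continuous_const.add continuous_id).rpow_const fun _ ↦ Or.inr (by norm_num))
    have h0 := (this.tendsto 0).mono_left (nhdsWithin_le_nhds (s := Set.Ioi 0))
    simpa only [add_zero] using h0
  exact ge_of_tendsto hlim (Filter.eventually_of_mem self_mem_nhdsWithin key)

theorem mainTheorem7 :
    ∃ κ : ℝ, 0 < κ ∧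
      ∀ (n : ℕ) (μ : Measure (EuclideanSpace ℝ (Fin n))) [IsProbabilityMeasure μ]
        (f : EuclideanSpace ℝ (Fin n) → ℝ),
        IsCompact μ.support →
        Metric.diam (convexHull ℝ μ.support) = Real.sqrt (n : ℝ) →
        ContDiff ℝ 1 f →
        ((Real.log (∫ x, Real.exp (f x) ∂μ) : ℝ) : EReal) ≤
          (⨆ y : EuclideanSpace ℝ (Fin n),
            ((f y : ℝ) : EReal) - legendreTransform (logLaplace μ) y) +
          ((κ * (n : ℝ) ^ ((1 : ℝ) / 3) *
            gaussianMeanWidth (∇ f '' convexHull ℝ μ.support) ^ ((2 : ℝ) / 3) : ℝ) : EReal) := by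
  refine ⟨5 / 2, by norm_num, fun n μ _ f hS hdiam hf ↦ ?_⟩
  have hμ : ∀ᵐ x ∂μ, x ∈ μ.support := Measure.support_mem_ae
  obtain ⟨x₀, hx₀⟩ : μ.support.Nonempty := Measure.nonempty_support (NeZero.ne μ)
  have hsub := subset_convexHull ℝ μ.support
  have hKb : Bornology.IsBounded (convexHull ℝ μ.support) := isBounded_convexHull.2 hS.isBounded
  have hV := hf.isBounded_gradient_image hKb
  have hne : (∇ f '' convexHull ℝ μ.support).Nonempty := ⟨_, x₀, hsub hx₀, rfl⟩
  have hfV : ∀ x ∈ μ.support, ∀ y ∈ closure (convexHull ℝ μ.support),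
      f x - f y ≤ supportFunction (∇ f '' convexHull ℝ μ.support) (x - y) := fun x hx y hy ↦
    hf.sub_le_supportFunction_gradient (convex_convexHull ℝ _) hV (hsub hx) hy
  have hD : ∀ x ∈ μ.support, ‖x - x₀‖ ≤ Real.sqrt n := fun x hx ↦ by
    rw [← dist_eq_norm, ← hdiam]
    exact Metric.dist_le_diam_of_mem hKb (hsub hx) (hsub hx₀)
  set Q := ⨆ y : EuclideanSpace ℝ (Fin n),
    ((f y : ℝ) : EReal) - legendreTransform (logLaplace μ) y with hQ
  -- The centre 0 is arbitrary: any centre shows that the supremum is not `⊥`.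
  obtain ⟨y, hy⟩ := exists_log_integral_le_sub_legendreTransform hS hμ hV hne hf.continuous hfV 0
  have hbot : Q ≠ ⊥ := ((EReal.bot_lt_coe _).trans_le (hy.trans (le_iSup_of_le y le_rfl))).ne'
  rcases eq_or_ne Q ⊤ with htop | htop
  · rw [htop, EReal.top_add_coe]
    exact le_top
  lift Q to ℝ using ⟨htop, hbot⟩ with q
  rw [← EReal.coe_add, EReal.coe_le_coe_iff, ← sub_le_iff_le_add']
  refine le_of_forall_pos_le_smoothing n.cast_nonneg
    (integral_supportFunction_stdGaussian_nonneg hV hne) fun r hr ↦ ?_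
  have h := log_integral_exp_le_of_pos hS hμ hV hne hf.continuous hfV hD
    (fun y ↦ hQ ▸ le_iSup_of_le y le_rfl) hr
  rw [Real.sq_sqrt n.cast_nonneg] at h
  exact sub_le_iff_le_add'.2 h
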